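/- Let $H_2$ be the set of $2\times 2$ complex hermitian matrices, let $\mathcal P$ be the set of rank one projections ($P=P^2=P^*$, $\operatorname{rank}P=1$), and put $P^\perp=I-P$. Let $\overline{H_2}$ be the set of all formal sums $aP+bP^\perp$ with $P\in\mathcal P$ and $a,b\in\mathbb R\cup\{\infty\}$, subject to the identifications $aP+bP^\perp=bP^\perp+aP$ and $aP+aP^\perp=aQ+aQ^\perp$. Thus $\overline{H_2}$ consists of the elements of $H_2$, of the points $\infty P+aP^\perp$ with $P\in\mathcal P$, $a\in\mathbb R$, and of one further point $\boldsymbol\infty=\infty P+\infty P^\perp$. The coherency relation $\sim$ on $\overline{H_2}$ is the symmetric relation given by: - for $A,B\in H_2$, $A\sim B$ if and only if $\operatorname{rank}(A-B)\le 1$; - for $A\in H_2$, $\infty P+aP^\perp\sim A$ if and only if $P^\perp AP^\perp=aP^\perp$; - $\infty P+aP^\perp\sim\infty Q+bQ^\perp$ (with $a,b\in\mathbb R$) if and only if $P=Q$; - $\boldsymbol\infty\sim X$ if and only if $X\notin H_2$. For $T\in H_2$ and an invertible $2\times2$ complex matrix $S$, the maps $X\mapsto -X$, $X\mapsto X+T$,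 $X\mapsto X^t$, $X\mapsto SXS^*$ are the usual ones on $H_2$. They fix $\boldsymbol\infty$ and send $\infty P+aP^\perp$ to $\infty P+(-a)P^\perp$, to $\infty P+(a+\operatorname{tr}(P^\perp T))P^\perp$, to $\infty P^t+a(P^t)^\perp$, and to $\infty Q+a\operatorname{tr}(Q^\perp SS^*)\,Q^\perp$ with $Q=SPS^*/\operatorname{tr}(SPS^*)$, respectively. An automorphism of $\overline{H_2}$ is a bijection $\psi:\overline{H_2}\to\overline{H_2}$ such that $X\sim Y\iff\psi(X)\sim\psi(Y)$ for all $X,Y$. An affine automorphism of $\overline{H_2}$ is an automorphism of the form $X\mapsto cSXS^*+T$ or $X\mapsto cSX^tS^*+T$ with $c\in\{-1,1\}$, $S$ an invertible $2\times 2$ complex matrix, and $T\in H_2$. **Theorem.** 1. Let $\varphi:H_2\to H_2$ be a bijection such that for all $A,B\in H_2$ $$\operatorname{rank}(A-B)\le 1\iff\operatorname{rank}(\varphi(A)-\varphi(B))\le 1 .$$ Then $\varphi$ extends to an affine automorphism of $\overline{H_2}$. 2. (Fundamental theorem of chronogeometry.) Let $\mathcal M_4=\mathbb R^4$ with events written $(x,y,z,t)$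 and $$\langle r_1,r_2\rangle=-x_1x_2-y_1y_2-z_1z_2+t_1t_2 .$$ Let $\phi:\mathcal M_4\to\mathcal M_4$ be a bijection such that for all $r_1,r_2\in\mathcal M_4$ $$\langle r_1-r_2,r_1-r_2\rangle=0\iff\langle\phi(r_1)-\phi(r_2),\phi(r_1)-\phi(r_2)\rangle=0 .$$ Then there are a real number $c>0$, a Lorentz matrix $Q$ (a real $4\times4$ matrix with $Q^tMQ=M$, where $M=\operatorname{diag}(-1,-1,-1,1)$) and $a\in\mathcal M_4$ such that $\phi(r)=c\,Qr+a$ for all $r\in\mathcal M_4$. -/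

import Mathlib

open scoped Matrix

namespace Chronogeometry

/-! ## Hermitian matrices and rank one projections -/

/-- `H₂`, the `2 × 2` complex hermitian matrices. -/
abbrev H2 : Type := selfAdjoint (Matrix (Fin 2) (Fin 2) ℂ)

/-- Coherency of hermitian matrices: `rank (B - A) ≤ 1`. -/
def H2.Coherent (A B : H2) : Prop :=
  ((B : Matrix (Fin 2) (Fin 2) ℂ) - (A : Matrix (Fin 2) (Fin 2) ℂ)).rank ≤ 1

/-- The transpose of a hermitian matrix. -/
def H2.transpose (A : H2) : H2 :=
  ⟨(A : Matrix (Fin 2) (Fin 2) ℂ)ᵀ, by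
    have h : (A : Matrix (Fin 2) (Fin 2) ℂ).IsHermitian := A.2
    exact h.transpose⟩

/-- `S A S*`. -/
def H2.congr (S : GL (Fin 2) ℂ) (A : H2) : H2 :=
  ⟨(S : Matrix (Fin 2) (Fin 2) ℂ) * (A : Matrix (Fin 2) (Fin 2) ℂ) *
      (S : Matrix (Fin 2) (Fin 2) ℂ)ᴴ, by
    have h : (A : Matrix (Fin 2) (Fin 2) ℂ).IsHermitian := A.2
    exact Matrix.isHermitian_mul_mul_conjTranspose _ h⟩

/-- A rank one projection on `ℂ²`: `P = P² = P*` and `rank P = 1`. -/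
@[ext] structure Proj where
  /-- the underlying matrix -/
  mat : Matrix (Fin 2) (Fin 2) ℂ
  idem : mat * mat = mat
  herm : mat.IsHermitian
  rank_eq : mat.rank = 1

/-- `P^⊥ = I - P`, as a matrix. -/
def Proj.perp (P : Proj) : Matrix (Fin 2) (Fin 2) ℂ := 1 - P.mat

/-- The transpose of a rank one projection. -/
def Proj.transpose (P : Proj) : Proj where
  mat := P.matᵀ
  idem := by rw [← Matrix.transpose_mul, P.idem]
  herm := P.herm.transpose
  rank_eq := by rw [Matrix.rank_transpose, P.rank_eq]

theorem Proj.mat_ne_zero (P : Proj) : P.mat ≠ 0 := by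
  intro h
  have h1 := P.rank_eq
  rw [h, Matrix.rank_zero] at h1
  exact zero_ne_one h1

theorem Proj.det_mat (P : Proj) : P.mat.det = 0 := by
  by_contra h
  have h1 : P.mat.rank = 2 := by
    have := Matrix.rank_of_isUnit P.mat
      ((Matrix.isUnit_iff_isUnit_det _).2 (isUnit_iff_ne_zero.2 h))
    simpa using this
  have h2 := P.rank_eq
  omega

open scoped ComplexOrder in
theorem Proj.trace_congr_ne_zero (S : GL (Fin 2) ℂ) (P : Proj) :
    ((S : Matrix (Fin 2) (Fin 2) ℂ) * P.mat * (S : Matrix (Fin 2) (Fin 2) ℂ)ᴴ).trace ≠ 0 := by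
  intro h
  have h1 : (S : Matrix (Fin 2) (Fin 2) ℂ) * P.mat * (S : Matrix (Fin 2) (Fin 2) ℂ)ᴴ
      = ((S : Matrix (Fin 2) (Fin 2) ℂ) * P.mat) *
        ((S : Matrix (Fin 2) (Fin 2) ℂ) * P.mat)ᴴ := by
    rw [Matrix.conjTranspose_mul, P.herm.eq, Matrix.mul_assoc, Matrix.mul_assoc,
      ← Matrix.mul_assoc P.mat P.mat, P.idem]
  rw [h1] at h
  have h2 : (S : Matrix (Fin 2) (Fin 2) ℂ) * P.mat = 0 :=
    Matrix.trace_mul_conjTranspose_self_eq_zero_iff.1 h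
  have h3 : ((S⁻¹ : GL (Fin 2) ℂ) : Matrix (Fin 2) (Fin 2) ℂ) *
      ((S : Matrix (Fin 2) (Fin 2) ℂ) * P.mat) = P.mat := by
    rw [← Matrix.mul_assoc, ← Units.val_mul, inv_mul_cancel, Units.val_one, Matrix.one_mul]
  rw [h2, Matrix.mul_zero] at h3
  exact P.mat_ne_zero h3.symm

/-- The rank one projection `Q = (tr (S P S*))⁻¹ S P S*`. -/
noncomputable def Proj.congr (S : GL (Fin 2) ℂ) (P : Proj) : Proj where
  mat := (((S : Matrix (Fin 2) (Fin 2) ℂ) * P.mat *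
      (S : Matrix (Fin 2) (Fin 2) ℂ)ᴴ).trace)⁻¹ •
    ((S : Matrix (Fin 2) (Fin 2) ℂ) * P.mat * (S : Matrix (Fin 2) (Fin 2) ℂ)ᴴ)
  idem := by
    have ht := Proj.trace_congr_ne_zero S P
    have hd : ((S : Matrix (Fin 2) (Fin 2) ℂ) * P.mat *
        (S : Matrix (Fin 2) (Fin 2) ℂ)ᴴ).det = 0 := by
      simp [Matrix.det_mul, P.det_mat]
    generalize (S : Matrix (Fin 2) (Fin 2) ℂ) * P.mat *
      (S : Matrix (Fin 2) (Fin 2) ℂ)ᴴ = N at ht hd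
    have hN : N * N = N.trace • N := by
      rw [Matrix.det_fin_two] at hd
      ext i j
      fin_cases i <;> fin_cases j <;>
        simp [Matrix.mul_apply, Fin.sum_univ_two, Matrix.trace_fin_two] <;>
        first | ring1 | linear_combination -hd
    rw [Matrix.smul_mul, Matrix.mul_smul, hN, smul_smul (N.trace⁻¹) N.trace,
      inv_mul_cancel₀ ht, one_smul]
  herm := by
    have hN := Matrix.isHermitian_mul_mul_conjTranspose
      (S : Matrix (Fin 2) (Fin 2) ℂ) P.herm
    generalize (S : Matrix (Fin 2) (Fin 2) ℂ) * P.mat *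
      (S : Matrix (Fin 2) (Fin 2) ℂ)ᴴ = N at hN
    have ht : star N.trace = N.trace := by
      rw [← Matrix.trace_conjTranspose, hN.eq]
    rw [Matrix.IsHermitian, Matrix.conjTranspose_smul, hN.eq, star_inv₀, ht]
  rank_eq := by
    have hc : IsUnit (Matrix.diagonal (fun _ : Fin 2 =>
        (((S : Matrix (Fin 2) (Fin 2) ℂ) * P.mat *
          (S : Matrix (Fin 2) (Fin 2) ℂ)ᴴ).trace)⁻¹)).det := by
      rw [Matrix.det_diagonal, isUnit_iff_ne_zero]
      exact Finset.prod_ne_zero_iff.2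
        fun _ _ => inv_ne_zero (Proj.trace_congr_ne_zero S P)
    rw [Matrix.smul_eq_diagonal_mul, Matrix.rank_mul_eq_right_of_isUnit_det _ _ hc]
    have hS : IsUnit (S : Matrix (Fin 2) (Fin 2) ℂ).det :=
      (Matrix.isUnit_iff_isUnit_det _).1 S.isUnit
    have hS' : IsUnit ((S : Matrix (Fin 2) (Fin 2) ℂ)ᴴ).det := by
      rw [Matrix.det_conjTranspose]; exact hS.star
    rw [Matrix.rank_mul_eq_left_of_isUnit_det _ _ hS',
      Matrix.rank_mul_eq_right_of_isUnit_det _ _ hS, P.rank_eq]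

/-! ## The compactification of `H₂` -/

/-- The compactification of `H₂`: all formal sums `a P + b P^⊥` with `P` a rank one projection and
`a, b ∈ ℝ ∪ {∞}`, where `a P + b P^⊥ = b P^⊥ + a P` and `a P + a P^⊥ = a Q + a Q^⊥`.
By the spectral theorem the sums with `a, b ∈ ℝ` are exactly the hermitian matrices; those with
exactly one infinite coefficient have a unique expression `∞ P + a P^⊥` with `a ∈ ℝ`; and all sums
with two infinite coefficients are one and the same point. -/
inductive HBar : Type
  /-- a hermitian matrix -/
  | fin (A : H2) : HBar
  /-- the point `∞ P + a P^⊥`, with `a ∈ ℝ` -/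
  | half (P : Proj) (a : ℝ) : HBar
  /-- the point `∞ P + ∞ P^⊥`, the same for all `P` -/
  | infty : HBar

namespace HBar

/-- The coherency relation on the compactification. -/
def Coherent : HBar → HBar → Prop
  | fin A, fin B => H2.Coherent A B
  | half P a, fin A =>
      P.perp * (A : Matrix (Fin 2) (Fin 2) ℂ) * P.perp = (a : ℂ) • P.perp
  | fin A, half P a =>
      P.perp * (A : Matrix (Fin 2) (Fin 2) ℂ) * P.perp = (a : ℂ) • P.perp
  | half P _, half Q _ => P = Q
  | infty, half _ _ => True
  | half _ _, infty => True
  | infty, infty => True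
  | infty, fin _ => False
  | fin _, infty => False

/-- An automorphism: a bijection that preserves coherency in both directions. -/
def IsAutomorphism (ψ : HBar → HBar) : Prop :=
  Function.Bijective ψ ∧ ∀ X Y : HBar, Coherent X Y ↔ Coherent (ψ X) (ψ Y)

/-- `X ↦ c X` for `c ∈ {1, -1}`, with the rule `-∞ = ∞`. -/
def signMul (c : ℤˣ) : HBar → HBar
  | fin A => fin ((c : ℤ) • A)
  | half P a => half P (((c : ℤ) : ℝ) * a)
  | infty => infty

/-- The translation `X ↦ X + B`; the number `tr (P^⊥ B)` is real. -/
def translate (B : H2) : HBar → HBar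
  | fin A => fin (A + B)
  | half P a => half P (a + (P.perp * (B : Matrix (Fin 2) (Fin 2) ℂ)).trace.re)
  | infty => infty

/-- The transposition `X ↦ Xᵗ`. -/
def transpose : HBar → HBar
  | fin A => fin A.transpose
  | half P a => half P.transpose a
  | infty => infty

/-- `X ↦ S X S*`, with `S (∞ P + a P^⊥) S* = ∞ Q + a tr (Q^⊥ S S*) Q^⊥` where
`Q = (tr (S P S*))⁻¹ S P S*`; the number `tr (Q^⊥ S S*)` is real. -/
noncomputable def congr (S : GL (Fin 2) ℂ) : HBar → HBar
  | fin A => fin (A.congr S)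
  | half P a => half (P.congr S)
      (a * ((P.congr S).perp * ((S : Matrix (Fin 2) (Fin 2) ℂ) *
        (S : Matrix (Fin 2) (Fin 2) ℂ)ᴴ)).trace.re)
  | infty => infty

/-- An affine automorphism: an automorphism of the form `X ↦ c S X S* + T` or
`X ↦ c S Xᵗ S* + T`, with `c ∈ {1, -1}`, `S` invertible and `T ∈ H₂`. -/
def IsAffineAutomorphism (ψ : HBar → HBar) : Prop :=
  IsAutomorphism ψ ∧
    ∃ (c : ℤˣ) (S : GL (Fin 2) ℂ) (T : H2),
      (∀ X : HBar, ψ X = translate T (signMul c (congr S X))) ∨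
      (∀ X : HBar, ψ X = translate T (signMul c (congr S (transpose X))))

end HBar

/-! ## Minkowski spacetime -/

/-- Spacetime events `(x, y, z, t)`. -/
abbrev M4 : Type := Fin 4 → ℝ

/-- The Lorentz--Minkowski indefinite inner product. -/
def lorentzInner (r s : M4) : ℝ :=
  -(r 0 * s 0) - r 1 * s 1 - r 2 * s 2 + r 3 * s 3

/-- The matrix `diag (-1, -1, -1, 1)`. -/
def lorentzM : Matrix (Fin 4) (Fin 4) ℝ := Matrix.diagonal ![-1, -1, -1, 1]

/-- Lorentz matrices: `Qᵗ M Q = M`. -/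
def IsLorentzMatrix (Q : Matrix (Fin 4) (Fin 4) ℝ) : Prop :=
  Qᵀ * lorentzM * Q = lorentzM

/-- Two events are lightlike if `⟨r - s, r - s⟩ = 0`. -/
def Lightlike (r s : M4) : Prop := lorentzInner (r - s) (r - s) = 0

end Chronogeometry

namespace Chronogeometry

/-! ## Bijections preserving the null cone of a Lorentzian form -/

/-! Since a 2×2 matrix has rank at most one exactly when its determinant vanishes, coherency says
that the difference is null for the quadratic form `det`, which has signature (1,3) on hermitian
matrices. Both statements thus concern bijections preserving the null relation of a Lorentzian form.

Three points pairwise separated by null vectors are collinear, so such a bijection carries null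
lines onto null lines. Parallel null lines joined by null segments have parallel images
(`IsLorentzian.image_parallel`), hence null parallelograms go to parallelograms, and since null
vectors generate the space (`IsLorentzian.closure_null`) the map is additive up to a translation. On
a null line it then scales by an additive function of the parameter; comparing two null lines shows
that this function is multiplicative on positive numbers, hence the identity. So the map is affine
(`IsLorentzian.exists_linear`).

A linear map preserving `det = 0` sends E₁₁ and E₂₂ to signed rank one matrices. A congruence and a
sign bring these back to E₁₁ and ±E₂₂, and what remains acts on the off-diagonal entry by an
isometry of ℂ: a rotation, or a rotation after conjugation, which is transposition. The affine
formula extends to the points at infinity, and coherency there becomes a trace condition. In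
Minkowski space `det` is the Lorentz form, and S scales it by |det S|², which gives the factor c =
|det S|. -/

/-- A symmetric bilinear form in which orthogonal null vectors are proportional and every nonzero
null vector belongs to a three-dimensional Lorentzian frame. -/
structure IsLorentzian {V : Type*} [AddCommGroup V] [Module ℝ V]
    (B : LinearMap.BilinForm ℝ V) : Prop where
  symm : ∀ x y, B x y = B y x
  proportional : ∀ p q, p ≠ 0 → B p p = 0 → B q q = 0 → B p q = 0 → ∃ t : ℝ, q = t • p
  frame : ∀ p, p ≠ 0 → B p p = 0 →
    ∃ q e, B q q = 0 ∧ B p q = 1 ∧ B p e = 0 ∧ B q e = 0 ∧ B e e = -2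

/-- The map preserves, in both directions, the relation that the difference is a null vector. -/
def PreservesNull {V : Type*} [AddCommGroup V] [Module ℝ V]
    (B : LinearMap.BilinForm ℝ V) (φ : V → V) : Prop :=
  ∀ x y, B (x - y) (x - y) = 0 ↔ B (φ x - φ y) (φ x - φ y) = 0

section Abstract

variable {V : Type*} [AddCommGroup V] [Module ℝ V] {B : LinearMap.BilinForm ℝ V}

/-! ### Null lines and null parallelograms -/

theorem IsLorentzian.sub_self (h : IsLorentzian B) (x y : V) :
    B (x - y) (x - y) = B x x - 2 * B x y + B y y := by
  simp only [map_sub, LinearMap.sub_apply]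
  rw [h.symm y x]; ring

theorem IsLorentzian.mem_line (h : IsLorentzian B) {a b x : V} (hab : b ≠ a)
    (h1 : B (b - a) (b - a) = 0) (h2 : B (x - a) (x - a) = 0) (h3 : B (x - b) (x - b) = 0) :
    ∃ t : ℝ, x - a = t • (b - a) := by
  apply h.proportional _ _ (sub_ne_zero.2 hab) h1 h2
  have h4 := h.sub_self (x - a) (b - a)
  rw [sub_sub_sub_cancel_right, h1, h2, h3, h.symm] at h4
  linarith

theorem IsLorentzian.image_line (h : IsLorentzian B) {φ : V → V} (hi : Function.Injective φ)
    (hφ : PreservesNull B φ) (a : V) {p : V} (hp : B p p = 0) (hp0 : p ≠ 0) (t : ℝ) :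
    ∃ s : ℝ, φ (a + t • p) - φ a = s • (φ (a + p) - φ a) := by
  apply h.mem_line
  · intro hh
    exact hp0 (by simpa using hi hh)
  · rw [← hφ]; simpa using hp
  · rw [← hφ]; simp [hp]
  · rw [← hφ]
    have : a + t • p - (a + p) = (t - 1) • p := by module
    simp [this, hp]

theorem IsLorentzian.preimage_line (h : IsLorentzian B) {φ : V → V} (hb : Function.Bijective φ)
    (hφ : PreservesNull B φ) (a : V) {p : V} (hp : B p p = 0) (hp0 : p ≠ 0) (s : ℝ) :
    ∃ t : ℝ, φ (a + t • p) = φ a + s • (φ (a + p) - φ a) := by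
  obtain ⟨x, hx⟩ := hb.2 (φ a + s • (φ (a + p) - φ a))
  have hD : B (φ (a + p) - φ a) (φ (a + p) - φ a) = 0 := by rw [← hφ]; simpa using hp
  obtain ⟨t, ht⟩ : ∃ t : ℝ, x - a = t • (a + p - a) := by
    apply h.mem_line
    · simpa using hp0
    · simpa using hp
    · rw [hφ, hx, add_sub_cancel_left, LinearMap.BilinForm.smul_left,
        LinearMap.BilinForm.smul_right, hD, mul_zero, mul_zero]
    · rw [hφ, hx]
      have : φ a + s • (φ (a + p) - φ a) - φ (a + p) = (s - 1) • (φ (a + p) - φ a) := by module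
      rw [this, LinearMap.BilinForm.smul_left, LinearMap.BilinForm.smul_right, hD, mul_zero, mul_zero]
  refine ⟨t, ?_⟩
  rw [← hx, show x = a + (x - a) by abel, ht]
  simp

/-- If the image directions D and D' were not orthogonal, the first image line would meet the null
hyperplane through the second. The meeting point φ(a + tp) is null-related to φ(a + q + tp) and the
difference is orthogonal to D', so it is a multiple of D'. The image lines then meet, and
injectivity makes q a multiple of p, against `B p q ≠ 0`. -/
theorem IsLorentzian.image_parallel (h : IsLorentzian B) {φ : V → V} (hb : Function.Bijective φ)
    (hφ : PreservesNull B φ) (a : V) {p q : V} (hp : B p p = 0) (hq : B q q = 0)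
    (hpq : B p q ≠ 0) :
    ∃ s : ℝ, φ (a + q + p) - φ (a + q) = s • (φ (a + p) - φ a) := by
  have hp0 : p ≠ 0 := by rintro rfl; simp at hpq
  have hD : B (φ (a + p) - φ a) (φ (a + p) - φ a) = 0 := by rw [← hφ]; simpa using hp
  have hD' : B (φ (a + q + p) - φ (a + q)) (φ (a + q + p) - φ (a + q)) = 0 := by
    rw [← hφ]; simpa using hp
  have hD0 : φ (a + p) - φ a ≠ 0 := by
    intro hh; exact hp0 (by simpa using hb.1 (sub_eq_zero.1 hh))
  have hD0' : φ (a + q + p) - φ (a + q) ≠ 0 := by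
    intro hh; exact hp0 (by simpa using hb.1 (sub_eq_zero.1 hh))
  apply h.proportional _ _ hD0 hD hD'
  by_contra hne
  -- a point of the first image line in the null hyperplane of the second one
  obtain ⟨t, ht⟩ := h.preimage_line hb hφ a hp hp0
    (B (φ (a + q) - φ a) (φ (a + q + p) - φ (a + q)) /
      B (φ (a + p) - φ a) (φ (a + q + p) - φ (a + q)))
  obtain ⟨s, hs⟩ := h.image_line hb.1 hφ (a + q) hp hp0 t
  set D := φ (a + p) - φ a
  set D' := φ (a + q + p) - φ (a + q)
  have horth : B D' (φ (a + t • p) - φ (a + q + t • p)) = 0 := by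
    have : φ (a + t • p) - φ (a + q + t • p) = (φ (a + t • p) - φ a) - (φ (a + q) - φ a)
        - (φ (a + q + t • p) - φ (a + q)) := by abel
    rw [this, hs, ht, h.symm]
    simp only [add_sub_cancel_left, LinearMap.BilinForm.sub_left, LinearMap.BilinForm.smul_left, hD']
    field_simp
    ring
  obtain ⟨c, hc⟩ := h.proportional _ _ hD0' hD' (by
    rw [← hφ]
    have : a + t • p - (a + q + t • p) = -q := by abel
    simp [this, hq]) horth
  obtain ⟨r, hr⟩ := h.preimage_line hb hφ (a + q) hp hp0 (s + c)
  have h1 : φ (a + q + r • p) = φ (a + t • p) := by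
    rw [hr, add_smul, ← hc, ← hs]; abel
  have h2 : q = (t - r) • p := by
    have := hb.1 h1
    rw [sub_smul, eq_sub_iff_add_eq]
    rw [add_assoc] at this
    exact add_left_cancel this
  rw [h2] at hpq
  simp [hp] at hpq

/-- Opposite sides have parallel images, so going round the quadrilateral gives D + yE = E + xD.
Pairing with the null vector E leaves x = 1, because D and E are not orthogonal: otherwise p - q
would be null. -/
theorem IsLorentzian.image_parallelogram (h : IsLorentzian B) {φ : V → V}
    (hb : Function.Bijective φ) (hφ : PreservesNull B φ) (a : V) {p q : V} (hp : B p p = 0)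
    (hq : B q q = 0) (hpq : B p q ≠ 0) :
    φ (a + q + p) - φ (a + q) = φ (a + p) - φ a := by
  obtain ⟨x, hx⟩ := h.image_parallel hb hφ a hp hq hpq
  obtain ⟨y, hy⟩ := h.image_parallel hb hφ a hq hp (by rwa [h.symm])
  have hD : B (φ (a + p) - φ a) (φ (a + p) - φ a) = 0 := by rw [← hφ]; simpa using hp
  have hE : B (φ (a + q) - φ a) (φ (a + q) - φ a) = 0 := by rw [← hφ]; simpa using hq
  have hDE : B (φ (a + p) - φ a) (φ (a + q) - φ a) ≠ 0 := by
    intro h0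
    have h1 := h.sub_self (φ (a + p) - φ a) (φ (a + q) - φ a)
    rw [hD, hE, h0, sub_sub_sub_cancel_right] at h1
    have h2 := (hφ (a + p) (a + q)).2 (by rw [h1]; ring)
    rw [add_sub_add_left_eq_sub, h.sub_self, hp, hq] at h2
    exact hpq (by linarith)
  have h3 : φ (a + p + q) = φ (a + q + p) := by rw [add_right_comm]
  rw [h3] at hy
  set D := φ (a + p) - φ a with hDdef
  set E := φ (a + q) - φ a with hEdef
  have h4 : D + y • E = E + x • D := by rw [← hx, ← hy, hDdef, hEdef]; abel
  have h5 := congrArg (fun v => B v E) h4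
  simp only [LinearMap.BilinForm.add_left, LinearMap.BilinForm.smul_left, hE] at h5
  have h6 : x = 1 := by
    apply mul_right_cancel₀ hDE; linarith
  rw [hx, h6, one_smul]

/-! ### Additivity -/

/-- Induction principle: the null vectors not orthogonal to a given null vector generate. -/
theorem IsLorentzian.closure_null (h : IsLorentzian B) {p : V} (hp : B p p = 0) (hp0 : p ≠ 0)
    (G : AddSubgroup V) (hG : ∀ q, B q q = 0 → B p q ≠ 0 → q ∈ G) (v : V) : v ∈ G := by
  obtain ⟨q, e, hq, hpq, hpe, hqe, he⟩ := h.frame p hp0 hp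
  have hqp : B q p = 1 := by rw [h.symm, hpq]
  have hep : B e p = 0 := by rw [h.symm, hpe]
  have heq : B e q = 0 := by rw [h.symm, hqe]
  have hqG : q ∈ G := hG q hq (by simp [hpq])
  have hsq : ∀ s : ℝ, (s ^ 2) • p ∈ G := by
    intro s
    -- The normalisation `B e e = -2` makes q + re + r²p null, with pairing 1 against p. Adding the
    -- vectors for r and -r cancels e, and r = s/√2 leaves exactly s²p.
    have h1 : ∀ r : ℝ, q + (r • e + r ^ 2 • p) ∈ G := by
      intro r
      apply hG
      · simp only [map_add, map_smul, LinearMap.add_apply, LinearMap.smul_apply, smul_eq_mul,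
          hp, hq, hpq, hqp, hpe, hep, hqe, heq, he]
        ring
      · simp [hp, hpq, hpe]
    have h2 := G.sub_mem (G.add_mem (h1 (s / √2)) (h1 (-(s / √2)))) (G.add_mem hqG hqG)
    have h3 : (s / √2) ^ 2 = s ^ 2 / 2 := by rw [div_pow, Real.sq_sqrt (by norm_num)]
    have h4 : q + ((s / √2) • e + (s / √2) ^ 2 • p) + (q + (-(s / √2) • e + (-(s / √2)) ^ 2 • p))
        - (q + q) = s ^ 2 • p := by
      rw [neg_sq, h3]; module
    rwa [h4] at h2
  have htp : ∀ t : ℝ, t • p ∈ G := by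
    intro t
    rcases le_total 0 t with ht | ht
    · simpa [Real.sq_sqrt ht] using hsq (√t)
    · have := G.neg_mem (hsq (√(-t)))
      rwa [Real.sq_sqrt (by linarith), neg_smul, neg_neg] at this
  have hne : ∀ w, B p w ≠ 0 → w ∈ G := by
    intro w hw
    have hwp : B w p = B p w := h.symm _ _
    -- This multiple of p makes the difference null without changing its pairing with p.
    have h1 : w - (B w w / (2 * B p w)) • p ∈ G := by
      apply hG
      · rw [h.sub_self]
        simp only [map_smul, LinearMap.smul_apply, smul_eq_mul, hp, hwp]
        field_simp
        ring
      · simpa [hp] using hw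
    simpa using G.add_mem h1 (htp (B w w / (2 * B p w)))
  by_cases hv : B p v = 0
  · have h1 := hne (v + q) (by simp [hv, hpq])
    simpa using G.sub_mem h1 hqG
  · exact hne v hv

/-- The translations that leave every increment of φ along p unchanged form a subgroup. By the
parallelogram lemma it contains all null vectors not orthogonal to p, so it is everything. -/
theorem IsLorentzian.map_add_null (h : IsLorentzian B) {φ : V → V} (hb : Function.Bijective φ)
    (hφ : PreservesNull B φ) {p : V} (hp : B p p = 0) (a : V) :
    φ (a + p) - φ a = φ p - φ 0 := by
  by_cases hp0 : p = 0
  · simp [hp0]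
  let G : AddSubgroup V :=
    { carrier := {v | ∀ b, φ (b + v + p) - φ (b + v) = φ (b + p) - φ b}
      zero_mem' := by intro b; simp
      add_mem' := by
        intro v w hv hw b
        rw [← add_assoc, hw, hv]
      neg_mem' := by
        intro v hv b
        have := hv (b + -v)
        rw [neg_add_cancel_right] at this
        exact this.symm }
  have h1 : a ∈ G := h.closure_null hp hp0 G
    (fun q hq hpq b => h.image_parallelogram hb hφ b hp hq hpq) a
  simpa using h1 0

theorem IsLorentzian.map_add (h : IsLorentzian B) (hV : ∃ p, p ≠ 0 ∧ B p p = 0) {φ : V → V}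
    (hb : Function.Bijective φ) (hφ : PreservesNull B φ) (h0 : φ 0 = 0) (a b : V) :
    φ (a + b) = φ a + φ b := by
  obtain ⟨p, hp0, hp⟩ := hV
  let G : AddSubgroup V :=
    { carrier := {v | ∀ b, φ (b + v) = φ b + φ v}
      zero_mem' := by intro b; simp [h0]
      add_mem' := by
        intro v w hv hw b
        rw [← add_assoc, hw, hv, hw v, add_assoc]
      neg_mem' := by
        intro v hv b
        have h1 := hv (b + -v)
        have h2 := hv (-v)
        rw [neg_add_cancel, h0] at h2
        rw [neg_add_cancel_right] at h1
        rw [h1, add_assoc, add_comm (φ v), ← h2, add_zero] }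
  have h1 : b ∈ G := h.closure_null hp hp0 G
    (fun q hq _ b => by
      have := h.map_add_null hb hφ hq b
      rw [h0, sub_zero] at this
      rw [← this]; abel) b
  exact h1 a

/-! ### Real homogeneity -/

/-- An additive function on the reals that is multiplicative on the positive reals and does not
vanish at `1` is the identity. -/
theorem eq_id_of_map_mul_pos {f : ℝ → ℝ} (hadd : ∀ x y, f (x + y) = f x + f y) (h1 : f 1 = 1)
    (hmul : ∀ x y, 0 < x → 0 < y → f (x * y) = f x * f y) (x : ℝ) : f x = x := by
  have h0 : f 0 = 0 := by have := hadd 0 0; simp at this; exact this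
  have hneg : ∀ x, f (-x) = -f x := by
    intro x; have := hadd x (-x); rw [add_neg_cancel, h0] at this; linarith
  have hmul' : ∀ x y, f (x * y) = f x * f y := by
    intro x y
    rcases lt_trichotomy x 0 with hx | rfl | hx
    · rcases lt_trichotomy y 0 with hy | rfl | hy
      · have := hmul (-x) (-y) (by linarith) (by linarith)
        rwa [neg_mul_neg, hneg, hneg, neg_mul_neg] at this
      · simp [h0]
      · have := hmul (-x) y (by linarith) hy
        rw [neg_mul, hneg, hneg] at this; linarith
    · simp [h0]
    · rcases lt_trichotomy y 0 with hy | rfl | hy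
      · have := hmul x (-y) hx (by linarith)
        rw [mul_neg, hneg, hneg] at this; linarith
      · simp [h0]
      · exact hmul x y hx hy
  let F : ℝ →+* ℝ :=
    { toFun := f, map_one' := h1, map_mul' := hmul', map_zero' := h0, map_add' := hadd }
  -- A ring endomorphism of ℝ preserves squares, hence the order, and so is the identity.
  have : F = RingHom.id ℝ := Subsingleton.elim _ _
  exact congrArg (fun g : ℝ →+* ℝ => g x) this

/-- Let f and g be the scale functions of φ on the lines of p and of a second null vector q. The
product f(s)g(t) depends only on st for positive s and t, since st = u² makes sp + tq + ue null.
Hence g = f there and f is multiplicative. -/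
theorem IsLorentzian.map_smul_null (h : IsLorentzian B) {φ : V → V} (hb : Function.Bijective φ)
    (hφ : PreservesNull B φ) (hadd : ∀ a b, φ (a + b) = φ a + φ b) {p : V} (hp : B p p = 0)
    (hp0 : p ≠ 0) (t : ℝ) : φ (t • p) = t • φ p := by
  have h0 : φ 0 = 0 := by have := hadd 0 0; simp at this; exact this
  have hneg : ∀ x, φ (-x) = -φ x := by
    intro x; have := hadd x (-x); rw [add_neg_cancel, h0] at this
    exact (neg_eq_of_add_eq_zero_right this.symm).symm
  have hnull : ∀ x, B x x = 0 ↔ B (φ x) (φ x) = 0 := by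
    intro x; have := hφ x 0; rwa [h0, sub_zero, sub_zero] at this
  obtain ⟨q, e, hq, hpq, hpe, hqe, he⟩ := h.frame p hp0 hp
  have hq0 : q ≠ 0 := by rintro rfl; simp at hpq
  have hline : ∀ r : V, B r r = 0 → r ≠ 0 → ∃ f : ℝ → ℝ, ∀ t, φ (t • r) = f t • φ r := by
    intro r hr hr0
    choose f hf using fun t => h.image_line hb.1 hφ 0 hr hr0 t
    exact ⟨f, fun t => by simpa [h0] using hf t⟩
  obtain ⟨f, hf⟩ := hline p hp hp0
  obtain ⟨g, hg⟩ := hline q hq hq0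
  have hφ0 : ∀ r, r ≠ 0 → φ r ≠ 0 := by
    intro r hr hh; exact hr (hb.1 (hh.trans h0.symm))
  have hone : ∀ r (f : ℝ → ℝ), r ≠ 0 → (∀ t, φ (t • r) = f t • φ r) → f 1 = 1 := by
    intro r f hr hf
    have := hf 1
    rw [one_smul] at this
    exact smul_left_injective ℝ (hφ0 r hr) (by simpa using this.symm)
  have hf1 := hone p f hp0 hf
  have hg1 := hone q g hq0 hg
  have hfadd : ∀ x y, f (x + y) = f x + f y := by
    intro x y
    apply smul_left_injective ℝ (hφ0 p hp0)
    simp only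
    rw [← hf, add_smul, hadd, hf, hf, add_smul]
  have hpp := (hnull p).1 hp
  have hqq := (hnull q).1 hq
  have hpq' : B (φ p) (φ q) ≠ 0 := by
    intro hh
    have h1 := (hnull (p - q)).2 (by
      rw [sub_eq_add_neg, hadd, hneg, ← sub_eq_add_neg, h.sub_self, hpp, hqq, hh]; ring)
    rw [h.sub_self, hp, hq, hpq] at h1
    norm_num at h1
  -- Both ±(sp + tq) + ue are null. Adding the two image equations removes the cross terms, so
  -- nothing need be known about the image of e.
  have key : ∀ s t u : ℝ, s * t = u ^ 2 →
      2 * (f s * g t * B (φ p) (φ q)) = -B (φ (u • e)) (φ (u • e)) := by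
    intro s t u hst
    have h1 : ∀ c : ℝ, c ^ 2 = 1 → 
        B (c • s • p + c • t • q + u • e) (c • s • p + c • t • q + u • e) = 0 := by
      intro c hc
      simp only [_root_.map_add, _root_.map_smul, LinearMap.add_apply, LinearMap.smul_apply, smul_eq_mul,
          hp, hq, hpq, hpe, hqe, he, h.symm q p, h.symm e p, h.symm e q]
      linear_combination (2 * s * t) * hc + 2 * hst
    have h2 := (hnull _).1 (h1 1 (by norm_num))
    have h3 := (hnull _).1 (h1 (-1) (by norm_num))
    simp only [one_smul, neg_smul, hadd, hneg, hf, hg] at h2 h3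
    simp only [_root_.map_add, _root_.map_smul, map_neg, LinearMap.add_apply, LinearMap.smul_apply,
      LinearMap.neg_apply, smul_eq_mul, hpp, hqq, h.symm (φ q) (φ p)] at h2 h3
    linarith
  have hprod : ∀ s t, 0 < s → 0 < t → f s * g t = f (s * t) := by
    intro s t hs ht
    have hu : (√(s * t)) ^ 2 = s * t := Real.sq_sqrt (by positivity)
    have h1 := key s t _ hu.symm
    have h2 := key (s * t) 1 (√(s * t)) (by rw [hu, mul_one])
    rw [← h2, hg1, mul_one] at h1
    exact mul_right_cancel₀ hpq' (by linarith)
  have hfg : ∀ t, 0 < t → g t = f t := by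
    intro t ht
    have := hprod 1 t one_pos ht
    rwa [hf1, one_mul, one_mul] at this
  rw [hf, eq_id_of_map_mul_pos hfadd hf1 (fun x y hx hy => by rw [← hprod x y hx hy, hfg y hy])]

theorem IsLorentzian.map_smul (h : IsLorentzian B) (hV : ∃ p, p ≠ 0 ∧ B p p = 0) {φ : V → V}
    (hb : Function.Bijective φ) (hφ : PreservesNull B φ) (hadd : ∀ a b, φ (a + b) = φ a + φ b)
    (t : ℝ) (v : V) : φ (t • v) = t • φ v := by
  obtain ⟨p, hp0, hp⟩ := hV
  let F : V →+ V := AddMonoidHom.mk' φ hadd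
  let G : AddSubgroup V :=
    { carrier := {v | F (t • v) = t • F v}
      zero_mem' := by simp
      add_mem' := by
        intro v w (hv : F (t • v) = t • F v) (hw : F (t • w) = t • F w)
        change F (t • (v + w)) = t • F (v + w)
        rw [smul_add, _root_.map_add, hv, hw, _root_.map_add, smul_add]
      neg_mem' := by
        intro v (hv : F (t • v) = t • F v)
        change F (t • (-v)) = t • F (-v)
        rw [smul_neg, map_neg, hv, map_neg, smul_neg] }
  exact h.closure_null hp hp0 G (fun q hq hpq =>
    h.map_smul_null hb hφ hadd hq (by rintro rfl; simp at hpq) t) v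

/-- A bijection preserving the null relation of a Lorentzian form is affine. -/
theorem IsLorentzian.exists_linear (h : IsLorentzian B) (hV : ∃ p, p ≠ 0 ∧ B p p = 0) {φ : V → V}
    (hb : Function.Bijective φ) (hφ : PreservesNull B φ) :
    ∃ L : V →ₗ[ℝ] V, ∀ x, φ x = L x + φ 0 := by
  let χ : V → V := fun x => φ x - φ 0
  have hbχ : Function.Bijective χ := (Equiv.subRight (φ 0)).bijective.comp hb
  have hχ : PreservesNull B χ := by
    intro x y
    rw [hφ x y]
    simp [χ]
  have hadd := h.map_add hV hbχ hχ (by simp [χ])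
  refine ⟨{ toFun := χ, map_add' := hadd, map_smul' := h.map_smul hV hbχ hχ hadd }, ?_⟩
  intro x
  simp [χ]

end Abstract

/-! ## Hermitian matrices in coordinates -/

theorem rank_le_one_iff_det_eq_zero (M : Matrix (Fin 2) (Fin 2) ℂ) : M.rank ≤ 1 ↔ M.det = 0 := by
  constructor
  · intro h
    by_contra hd
    have := Matrix.rank_of_det_ne_zero hd
    simp at this
    omega
  · intro h
    obtain ⟨v, hv, hMv⟩ := Matrix.exists_mulVec_eq_zero_iff.2 h
    have h1 := LinearMap.finrank_range_add_finrank_ker M.mulVecLin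
    have h2 : 0 < Module.finrank ℂ (LinearMap.ker M.mulVecLin) :=
      Module.finrank_pos_iff_exists_ne_zero.2 ⟨⟨v, by simpa using hMv⟩, by simpa using hv⟩
    simp only [Module.finrank_fintype_fun_eq_card, Fintype.card_fin] at h1
    rw [Matrix.rank]
    omega

/-- The determinant of a hermitian matrix, as a real number. -/
def H2.det (A : H2) : ℝ := (A : Matrix (Fin 2) (Fin 2) ℂ).det.re

/-- The hermitian matrix with diagonal entries `s`, `t` and upper right entry `z`. -/
def herm (s t : ℝ) (z : ℂ) : H2 :=
  ⟨!![(s : ℂ), z; star z, (t : ℂ)], by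
    change star _ = _
    ext i j
    fin_cases i <;> fin_cases j <;> simp [Matrix.star_apply]⟩

@[simp] theorem coe_herm (s t : ℝ) (z : ℂ) :
    (herm s t z : Matrix (Fin 2) (Fin 2) ℂ) = !![(s : ℂ), z; star z, (t : ℂ)] := rfl

theorem exists_eq_herm (A : H2) : ∃ s t z, A = herm s t z := by
  have hA : ∀ i j, star ((A : Matrix (Fin 2) (Fin 2) ℂ) j i) = (A : Matrix (Fin 2) (Fin 2) ℂ) i j := by
    intro i j
    have h : (A : Matrix (Fin 2) (Fin 2) ℂ).IsHermitian := A.2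
    exact h.apply i j
  refine ⟨((A : Matrix (Fin 2) (Fin 2) ℂ) 0 0).re, ((A : Matrix (Fin 2) (Fin 2) ℂ) 1 1).re,
    (A : Matrix (Fin 2) (Fin 2) ℂ) 0 1, ?_⟩
  apply Subtype.ext
  ext i j
  fin_cases i <;> fin_cases j
  · exact (Complex.conj_eq_iff_re.1 (hA 0 0)).symm
  · rfl
  · exact (hA 1 0).symm
  · exact (Complex.conj_eq_iff_re.1 (hA 1 1)).symm

theorem herm_injective {s t s' t' : ℝ} {z z' : ℂ} (h : herm s t z = herm s' t' z') :
    s = s' ∧ t = t' ∧ z = z' := by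
  have h1 := congrArg (fun A : H2 => (A : Matrix (Fin 2) (Fin 2) ℂ)) h
  have h00 := congrFun (congrFun h1 0) 0
  have h01 := congrFun (congrFun h1 0) 1
  have h11 := congrFun (congrFun h1 1) 1
  simp at h00 h01 h11
  exact ⟨h00, h11, h01⟩

theorem herm_add (s t s' t' : ℝ) (z z' : ℂ) :
    herm s t z + herm s' t' z' = herm (s + s') (t + t') (z + z') := by
  apply Subtype.ext
  ext i j
  fin_cases i <;> fin_cases j <;> simp

theorem smul_herm (r s t : ℝ) (z : ℂ) : r • herm s t z = herm (r * s) (r * t) (r * z) := by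
  apply Subtype.ext
  ext i j
  fin_cases i <;> fin_cases j <;> simp

theorem neg_herm (s t : ℝ) (z : ℂ) : -herm s t z = herm (-s) (-t) (-z) := by
  apply Subtype.ext
  ext i j
  fin_cases i <;> fin_cases j <;> simp

theorem det_herm (s t : ℝ) (z : ℂ) : (herm s t z).det = s * t - (z.re ^ 2 + z.im ^ 2) := by
  simp [H2.det, Matrix.det_fin_two]
  ring

theorem H2.coe_det (A : H2) : (A : Matrix (Fin 2) (Fin 2) ℂ).det = (A.det : ℂ) := by
  obtain ⟨s, t, z, rfl⟩ := exists_eq_herm A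
  apply Complex.ext
  · rfl
  · simp [Matrix.det_fin_two]
    ring

theorem H2.coherent_iff (A B : H2) : H2.Coherent A B ↔ (B - A).det = 0 := by
  rw [H2.Coherent, rank_le_one_iff_det_eq_zero]
  rw [← AddSubgroupClass.coe_sub, H2.coe_det, Complex.ofReal_eq_zero]

theorem H2.det_neg (A : H2) : (-A).det = A.det := by
  obtain ⟨s, t, z, rfl⟩ := exists_eq_herm A
  rw [neg_herm, det_herm, det_herm]
  simp

/-- The symmetric bilinear form with `B(A, A) = 2 det A`. -/
noncomputable def detForm : LinearMap.BilinForm ℝ H2 :=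
  LinearMap.mk₂ ℝ (fun X Y : H2 =>
    ((X : Matrix (Fin 2) (Fin 2) ℂ) 0 0 * (Y : Matrix (Fin 2) (Fin 2) ℂ) 1 1 +
      (X : Matrix (Fin 2) (Fin 2) ℂ) 1 1 * (Y : Matrix (Fin 2) (Fin 2) ℂ) 0 0 -
      (X : Matrix (Fin 2) (Fin 2) ℂ) 0 1 * (Y : Matrix (Fin 2) (Fin 2) ℂ) 1 0 -
      (X : Matrix (Fin 2) (Fin 2) ℂ) 1 0 * (Y : Matrix (Fin 2) (Fin 2) ℂ) 0 1).re)
    (by intros; simp; ring) (by intros; simp; ring) (by intros; simp; ring) (by intros; simp; ring)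

theorem detForm_herm (s t s' t' : ℝ) (z z' : ℂ) :
    detForm (herm s t z) (herm s' t' z') =
      s * t' + t * s' - 2 * (z.re * z'.re + z.im * z'.im) := by
  simp [detForm]
  ring

theorem detForm_self (A : H2) : detForm A A = 2 * A.det := by
  obtain ⟨s, t, z, rfl⟩ := exists_eq_herm A
  rw [detForm_herm, det_herm]
  ring

theorem isLorentzian_detForm : IsLorentzian detForm where
  symm X Y := by
    obtain ⟨s, t, z, rfl⟩ := exists_eq_herm X
    obtain ⟨s', t', z', rfl⟩ := exists_eq_herm Y
    rw [detForm_herm, detForm_herm]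
    ring
  proportional p q hp0 hp hq hpq := by
    obtain ⟨s, t, z, rfl⟩ := exists_eq_herm p
    obtain ⟨s', t', z', rfl⟩ := exists_eq_herm q
    rw [detForm_herm] at hp hq hpq
    by_cases hs : s = 0
    · subst hs
      have hz1 : z.re = 0 := by nlinarith [sq_nonneg z.re, sq_nonneg z.im]
      have hz2 : z.im = 0 := by nlinarith [sq_nonneg z.re, sq_nonneg z.im]
      have hz : z = 0 := Complex.ext hz1 hz2
      subst hz
      have ht : t ≠ 0 := by
        rintro rfl
        apply hp0
        apply Subtype.ext
        ext i j
        fin_cases i <;> fin_cases j <;> simp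
      simp only [Complex.zero_re, Complex.zero_im] at hpq
      have hs' : s' = 0 := by
        apply (mul_eq_zero.1 (show t * s' = 0 by linarith)).resolve_left ht
      subst hs'
      have hz1' : z'.re = 0 := by nlinarith [sq_nonneg z'.re, sq_nonneg z'.im]
      have hz2' : z'.im = 0 := by nlinarith [sq_nonneg z'.re, sq_nonneg z'.im]
      have hz' : z' = 0 := Complex.ext hz1' hz2'
      subst hz'
      refine ⟨t' / t, ?_⟩
      rw [smul_herm]
      simp [ht]
    -- The combination s·q - s'·p is null, as p and q are null and orthogonal; its upper left entry
    -- is 0, so its determinant is minus this sum of squares.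
    · have h1 : (s * z'.re - s' * z.re) ^ 2 + (s * z'.im - s' * z.im) ^ 2 = 0 := by
        linear_combination (-s ^ 2 / 2) * hq + (-s' ^ 2 / 2) * hp + s * s' * hpq
      have h2 : s * z'.re - s' * z.re = 0 := by
        nlinarith [sq_nonneg (s * z'.re - s' * z.re), sq_nonneg (s * z'.im - s' * z.im)]
      have h3 : s * z'.im - s' * z.im = 0 := by
        nlinarith [sq_nonneg (s * z'.re - s' * z.re), sq_nonneg (s * z'.im - s' * z.im)]
      have hr : z'.re = s' / s * z.re := by field_simp; linarith
      have hi : z'.im = s' / s * z.im := by field_simp; linarith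
      have ht : t' = s' / s * t := by
        rw [hr, hi] at hpq
        field_simp
        field_simp at hpq
        have : s * (s * t' - s' * t) = 0 := by linear_combination hpq - s' * hp
        linarith [(mul_eq_zero.1 this).resolve_left hs]
      refine ⟨s' / s, ?_⟩
      rw [smul_herm, div_mul_cancel₀ _ hs, ← ht]
      congr 1
      apply Complex.ext <;> simp [-Complex.ofReal_div, hr, hi]
  frame p hp0 hp := by
    obtain ⟨s, t, z, rfl⟩ := exists_eq_herm p
    rw [detForm_herm] at hp
    by_cases hs : s = 0
    · subst hs
      have hz1 : z.re = 0 := by nlinarith [sq_nonneg z.re, sq_nonneg z.im]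
      have hz2 : z.im = 0 := by nlinarith [sq_nonneg z.re, sq_nonneg z.im]
      have hz : z = 0 := Complex.ext hz1 hz2
      subst hz
      have ht : t ≠ 0 := by
        rintro rfl
        apply hp0
        apply Subtype.ext
        ext i j
        fin_cases i <;> fin_cases j <;> simp
      refine ⟨herm t⁻¹ 0 0, herm 0 0 1, ?_, ?_, ?_, ?_, ?_⟩ <;> rw [detForm_herm] <;> simp [ht]
    -- The lower right entry of e is chosen to cancel the off-diagonal contribution -2 Re z to the
    -- pairing with p.
    · refine ⟨herm 0 s⁻¹ 0, herm 0 (2 * z.re / s) 1, ?_, ?_, ?_, ?_, ?_⟩ <;>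
        rw [detForm_herm] <;> simp [hs]
      field_simp
      simp

/-! ## The action of the general linear group -/

theorem H2.congr_mul (S S' : GL (Fin 2) ℂ) (A : H2) :
    H2.congr (S * S') A = H2.congr S (H2.congr S' A) := by
  apply Subtype.ext
  simp [H2.congr, Matrix.mul_assoc]

@[simp] theorem H2.congr_one (A : H2) : H2.congr 1 A = A := by
  apply Subtype.ext
  simp [H2.congr]

/-- `A ↦ S A S*` as a real linear map. -/
def H2.congrLin (S : GL (Fin 2) ℂ) : H2 →ₗ[ℝ] H2 where
  toFun := H2.congr S
  map_add' A B := by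
    apply Subtype.ext
    simp [H2.congr, Matrix.mul_add, Matrix.add_mul]
  map_smul' r A := by
    apply Subtype.ext
    simp [H2.congr]

theorem H2.congrLin_apply (S : GL (Fin 2) ℂ) (A : H2) : H2.congrLin S A = H2.congr S A := rfl

theorem det_coe_ne_zero (S : GL (Fin 2) ℂ) : (S : Matrix (Fin 2) (Fin 2) ℂ).det ≠ 0 :=
  ((Matrix.isUnit_iff_isUnit_det _).1 S.isUnit).ne_zero

theorem H2.det_congr (S : GL (Fin 2) ℂ) (A : H2) :
    (H2.congr S A).det = ‖(S : Matrix (Fin 2) (Fin 2) ℂ).det‖ ^ 2 * A.det := by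
  have h : (((H2.congr S A).det : ℝ) : ℂ) =
      ((‖(S : Matrix (Fin 2) (Fin 2) ℂ).det‖ ^ 2 * A.det : ℝ) : ℂ) := by
    rw [← H2.coe_det, H2.congr, Matrix.det_mul, Matrix.det_mul, Matrix.det_conjTranspose,
      H2.coe_det]
    push_cast
    rw [← Complex.mul_conj']
    simp only [starRingEnd_apply]
    ring
  exact_mod_cast h

theorem H2.transpose_herm (s t : ℝ) (z : ℂ) : (herm s t z).transpose = herm s t (star z) := by
  apply Subtype.ext
  ext i j
  fin_cases i <;> fin_cases j <;> simp [H2.transpose]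

theorem H2.det_transpose (A : H2) : A.transpose.det = A.det := by
  simp [H2.det, H2.transpose]

theorem H2.congr_mkOfDetNeZero (a b c d : ℂ) (h : (!![a, b; c, d]).det ≠ 0) (s t : ℝ) (z : ℂ) :
    ((H2.congr (Matrix.GeneralLinearGroup.mkOfDetNeZero !![a, b; c, d] h) (herm s t z) : H2) :
      Matrix (Fin 2) (Fin 2) ℂ) =
      !![a, b; c, d] * !![(s : ℂ), z; star z, (t : ℂ)] * !![star a, star c; star b, star d] := by
  have : (!![a, b; c, d])ᴴ = !![star a, star c; star b, star d] := by
    ext i j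
    fin_cases i <;> fin_cases j <;> rfl
  rw [← this]
  rfl

/-! ### Linear maps preserving singularity -/

/-- Since st = |z|² ≥ 0, the diagonal entries have a common sign. After factoring it out, the matrix
is vv* with v = (√s, z̄/√s), or v = (0, √t) when s = 0. -/
theorem exists_eq_rank_one {s t : ℝ} {z : ℂ} (h : (herm s t z).det = 0) :
    ∃ (c : ℤˣ) (a b : ℂ), herm s t z = (c : ℤ) • herm (‖a‖ ^ 2) (‖b‖ ^ 2) (a * star b) := by
  have main : ∀ (s t : ℝ) (z : ℂ), (herm s t z).det = 0 → 0 ≤ s → 0 ≤ t →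
      ∃ a b : ℂ, herm s t z = herm (‖a‖ ^ 2) (‖b‖ ^ 2) (a * star b) := by
    intro s t z h hs ht
    rw [det_herm] at h
    rcases hs.eq_or_lt with rfl | hs
    · have hz1 : z.re = 0 := by nlinarith [sq_nonneg z.re, sq_nonneg z.im]
      have hz2 : z.im = 0 := by nlinarith [sq_nonneg z.re, sq_nonneg z.im]
      have hz : z = 0 := Complex.ext hz1 hz2
      subst hz
      refine ⟨0, (√t : ℝ), ?_⟩
      simp [Real.sq_sqrt ht]
    · have hq : √s ^ 2 = s := Real.sq_sqrt hs.le
      have hq0 : √s ≠ 0 := (Real.sqrt_pos.2 hs).ne'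
      have hq0' : ((√s : ℝ) : ℂ) ≠ 0 := by exact_mod_cast hq0
      refine ⟨(√s : ℝ), star z / (√s : ℝ), ?_⟩
      congr 1
      · simp [hq]
      · rw [norm_div, norm_star, div_pow, Complex.sq_norm, Complex.normSq_apply]
        simp only [Complex.norm_real, Real.norm_eq_abs, sq_abs, hq]
        field_simp
        linarith
      · simp
        field_simp
  by_cases hst : 0 ≤ s ∧ 0 ≤ t
  · obtain ⟨a, b, hab⟩ := main s t z h hst.1 hst.2
    exact ⟨1, a, b, by simpa using hab⟩
  · have hst' : s ≤ 0 ∧ t ≤ 0 := by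
      rw [det_herm] at h
      have : 0 ≤ s * t := by nlinarith [sq_nonneg z.re, sq_nonneg z.im]
      rcases mul_nonneg_iff.1 this with h1 | h1
      · exact absurd h1 hst
      · exact h1
    obtain ⟨a, b, hab⟩ := main (-s) (-t) (-z) (by rw [← neg_herm, H2.det_neg, h])
      (by linarith) (by linarith)
    refine ⟨-1, a, b, ?_⟩
    rw [← hab, ← neg_herm]
    simp

/-- A linear map preserving singularity that fixes `E₁₁` and `± E₂₂` is a congruence, up to
transposition. -/
theorem exists_congr_of_fixed (L : H2 →ₗ[ℝ] H2) (hL : ∀ X : H2, X.det = 0 ↔ (L X).det = 0)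
    (h1 : L (herm 1 0 0) = herm 1 0 0) (c : ℤˣ) (h2 : L (herm 0 1 0) = (c : ℤ) • herm 0 1 0) :
    ∃ S : GL (Fin 2) ℂ, (∀ X, L X = H2.congr S X) ∨ ∀ X, L X = H2.congr S X.transpose := by
  have hdecomp : ∀ s t z, herm s t z = s • herm 1 0 0 + t • herm 0 1 0 + herm 0 0 z := by
    intro s t z
    rw [smul_herm, smul_herm, herm_add, herm_add]
    simp
  choose a b h hh using fun z => exists_eq_herm (L (herm 0 0 z))
  have hc : c = 1 := by
    rcases Int.units_eq_one_or c with rfl | rfl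
    · rfl
    · exfalso
      -- Three points of the hyperbola st = 1 force a = b = 0 and then |h|² = -1, so c = -1 is
      -- impossible.
      have key : ∀ s t : ℝ, s * t = 1 →
          (s + a 1) * (-t + b 1) - ((h 1).re ^ 2 + (h 1).im ^ 2) = 0 := by
        intro s t hst
        have := (hL (herm s t 1)).1 (by rw [det_herm]; simp [hst])
        rw [hdecomp, map_add, map_add, map_smul, map_smul, h1, h2, hh] at this
        simp only [Units.val_neg, Units.val_one, neg_smul, one_smul, smul_neg] at this
        rw [smul_herm, smul_herm, neg_herm, herm_add, herm_add, det_herm] at this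
        simpa using this
      have k1 := key 1 1 (by norm_num)
      have k2 := key (-1) (-1) (by norm_num)
      nlinarith [sq_nonneg (h 1).re, sq_nonneg (h 1).im, key 2 (1 / 2) (by norm_num)]
  subst hc
  rw [Units.val_one, one_smul] at h2
  have hLh : ∀ s t z, L (herm s t z) = herm (s + a z) (t + b z) (h z) := by
    intro s t z
    rw [hdecomp, map_add, map_add, map_smul, map_smul, h1, h2, hh, smul_herm, smul_herm, herm_add,
      herm_add]
    simp
  have key : ∀ (s t : ℝ) (z : ℂ), s * t = z.re ^ 2 + z.im ^ 2 →
      (s + a z) * (t + b z) = (h z).re ^ 2 + (h z).im ^ 2 := by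
    intro s t z hst
    have := (hL (herm s t z)).1 (by rw [det_herm]; linarith)
    rw [hLh, det_herm] at this
    linarith
  have hz : ∀ z, a z = 0 ∧ b z = 0 ∧ (h z).re ^ 2 + (h z).im ^ 2 = z.re ^ 2 + z.im ^ 2 := by
    intro z
    have k1 := key 1 (z.re ^ 2 + z.im ^ 2) z (by ring)
    have k2 := key (-1) (-(z.re ^ 2 + z.im ^ 2)) z (by ring)
    have k3 := key 2 ((z.re ^ 2 + z.im ^ 2) / 2) z (by ring)
    have k4 := key (-2) (-((z.re ^ 2 + z.im ^ 2) / 2)) z (by ring)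
    have hb : b z = 0 := by linarith
    rw [hb] at k1 k2
    -- For z = 0 the earlier equations say nothing about a once b = 0; exchanging the roles of s and
    -- t covers that case.
    have k5 := key (z.re ^ 2 + z.im ^ 2) 1 z (by ring)
    have k6 := key (-(z.re ^ 2 + z.im ^ 2)) (-1) z (by ring)
    rw [hb] at k5 k6
    have ha : a z = 0 := by linarith
    rw [ha] at k1
    exact ⟨ha, hb, by linarith⟩
  have hLh' : ∀ s t z, L (herm s t z) = herm s t (h z) := by
    intro s t z
    rw [hLh, (hz z).1, (hz z).2.1, add_zero, add_zero]
  let hlin : ℂ →ₗ[ℝ] ℂ :=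
    { toFun := h
      map_add' := by
        intro x y
        have := L.map_add (herm 0 0 x) (herm 0 0 y)
        rw [herm_add, hLh', hLh', hLh', herm_add] at this
        exact (herm_injective this).2.2
      map_smul' := by
        intro r x
        have := L.map_smul r (herm 0 0 x)
        rw [smul_herm, hLh', hLh', smul_herm] at this
        simpa using (herm_injective this).2.2 }
  let hiso : ℂ →ₗᵢ[ℝ] ℂ :=
    { hlin with
      norm_map' := by
        intro z
        change ‖h z‖ = ‖z‖
        rw [← sq_eq_sq₀ (norm_nonneg _) (norm_nonneg _), Complex.sq_norm, Complex.sq_norm,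
          Complex.normSq_apply, Complex.normSq_apply]
        linarith [(hz z).2.2] }
  -- The linear isometries of ℂ are z ↦ wz and z ↦ wz̄ with |w| = 1. Congruence by diag(w, 1)
  -- realises the first, and preceded by transposition the second.
  obtain ⟨w, hw⟩ := linear_isometry_complex (hiso.toLinearIsometryEquiv rfl)
  have hw0 : (!![(w : ℂ), 0; 0, 1]).det ≠ 0 := by simp [Matrix.det_fin_two]
  have hrot : ∀ s t z, H2.congr (Matrix.GeneralLinearGroup.mkOfDetNeZero !![(w : ℂ), 0; 0, 1] hw0)
      (herm s t z) = herm s t (w * z) := by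
    intro s t z
    apply Subtype.ext
    rw [H2.congr_mkOfDetNeZero]
    have hww : (w : ℂ) * (starRingEnd ℂ) w = 1 := by simp [Complex.mul_conj]
    ext i j
    fin_cases i <;> fin_cases j <;> simp [mul_comm]
    linear_combination (s : ℂ) * hww
  refine ⟨Matrix.GeneralLinearGroup.mkOfDetNeZero !![(w : ℂ), 0; 0, 1] hw0, ?_⟩
  refine hw.imp (fun hw X => ?_) (fun hw X => ?_)
  · obtain ⟨s, t, z, rfl⟩ := exists_eq_herm X
    rw [hrot, hLh']
    congr 1
    exact congrArg (fun f : ℂ ≃ₗᵢ[ℝ] ℂ => f z) hw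
  · obtain ⟨s, t, z, rfl⟩ := exists_eq_herm X
    rw [H2.transpose_herm, hrot, hLh']
    congr 1
    exact congrArg (fun f : ℂ ≃ₗᵢ[ℝ] ℂ => f z) hw

/-- A linear map of hermitian matrices preserving singularity in both directions is, up to sign and
transposition, a congruence. -/
theorem exists_congr_of_linear (L : H2 →ₗ[ℝ] H2) (hL : ∀ X : H2, X.det = 0 ↔ (L X).det = 0) :
    ∃ (c : ℤˣ) (S : GL (Fin 2) ℂ),
      (∀ X, L X = (c : ℤ) • H2.congr S X) ∨ ∀ X, L X = (c : ℤ) • H2.congr S X.transpose := by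
  have hsq : ∀ (c : ℤˣ) (X : H2), (c : ℤ) • (c : ℤ) • X = X := by
    intro c X
    rw [smul_smul, ← Units.val_mul, Int.units_mul_self, Units.val_one, one_smul]
  obtain ⟨s₁, t₁, z₁, e₁⟩ := exists_eq_herm (L (herm 1 0 0))
  obtain ⟨s₂, t₂, z₂, e₂⟩ := exists_eq_herm (L (herm 0 1 0))
  obtain ⟨c₁, a, c, r₁⟩ := exists_eq_rank_one (s := s₁) (t := t₁) (z := z₁)
    (by rw [← e₁, ← hL, det_herm]; simp)
  obtain ⟨c₂, b, d, r₂⟩ := exists_eq_rank_one (s := s₂) (t := t₂) (z := z₂)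
    (by rw [← e₂, ← hL, det_herm]; simp)
  rw [r₁] at e₁
  rw [r₂] at e₂
  -- With v = (a, c) and w = (b, d), the image of the identity matrix is c₁vv* + c₂ww*, whose
  -- determinant is c₁c₂|ad - bc|². It cannot vanish because the identity is nonsingular.
  have hS : (!![a, b; c, d]).det ≠ 0 := by
    intro h0
    rw [Matrix.det_fin_two_of] at h0
    have h1 : (herm 1 0 0 + herm 0 1 0).det ≠ 0 := by
      rw [herm_add, det_herm]; simp
    apply h1
    rw [hL, map_add, e₁, e₂, ← Complex.ofReal_eq_zero, ← H2.coe_det, Matrix.det_fin_two]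
    have hn : ∀ x : ℂ, ((‖x‖ : ℝ) : ℂ) ^ 2 = x * star x := fun x => (Complex.mul_conj' x).symm
    have h0' : star a * star d - star b * star c = 0 := by
      rw [← star_mul', ← star_mul', ← star_sub, h0, star_zero]
    simp only [AddSubgroup.coe_add, AddSubgroupClass.coe_zsmul, coe_herm,
      Matrix.add_apply, Matrix.smul_apply, Matrix.of_apply, Matrix.cons_val', Matrix.cons_val_zero,
      Matrix.cons_val_one, Matrix.cons_val_fin_one, Complex.ofReal_pow]
    simp only [hn, zsmul_eq_mul, star_mul', star_star]
    linear_combination ((c₁ : ℤ) : ℂ) * ((c₂ : ℤ) : ℂ) * (star a * star d - star b * star c) * h0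
  set S := Matrix.GeneralLinearGroup.mkOfDetNeZero !![a, b; c, d] hS
  have hS1 : H2.congr S (herm 1 0 0) = herm (‖a‖ ^ 2) (‖c‖ ^ 2) (a * star c) := by
    apply Subtype.ext
    rw [H2.congr_mkOfDetNeZero]
    ext i j
    fin_cases i <;> fin_cases j <;> simp [← Complex.mul_conj', mul_comm]
  have hS2 : H2.congr S (herm 0 1 0) = herm (‖b‖ ^ 2) (‖d‖ ^ 2) (b * star d) := by
    apply Subtype.ext
    rw [H2.congr_mkOfDetNeZero]
    ext i j
    fin_cases i <;> fin_cases j <;> simp [← Complex.mul_conj', mul_comm]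
  have hinv : ∀ X, H2.congr S⁻¹ (H2.congr S X) = X := by
    intro X; rw [← H2.congr_mul, inv_mul_cancel, H2.congr_one]
  have hinv' : ∀ X, H2.congr S (H2.congr S⁻¹ X) = X := by
    intro X; rw [← H2.congr_mul, mul_inv_cancel, H2.congr_one]
  -- S carries E₁₁ and E₂₂ to vv* and ww*, so this map fixes E₁₁ and sends E₂₂ to c₁c₂E₂₂.
  let L' : H2 →ₗ[ℝ] H2 := (c₁ : ℤ) • (H2.congrLin S⁻¹ ∘ₗ L)
  have hL'def : ∀ X, L' X = (c₁ : ℤ) • H2.congr S⁻¹ (L X) := fun X => rfl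
  have hzs : ∀ (S : GL (Fin 2) ℂ) (n : ℤ) (X : H2), H2.congr S (n • X) = n • H2.congr S X :=
    fun S n X => map_zsmul (H2.congrLin S) n X
  have hdet0 : ∀ (c : ℤˣ) (X : H2), ((c : ℤ) • X).det = X.det := by
    intro c X
    rcases Int.units_eq_one_or c with rfl | rfl
    · simp
    · simp [H2.det_neg]
  obtain ⟨S', hS'⟩ := exists_congr_of_fixed L' (by
      intro X
      rw [hL'def, hdet0, H2.det_congr, mul_eq_zero, hL]
      simp [det_coe_ne_zero])
    (by rw [hL'def, e₁, hzs, hsq, ← hS1, hinv]) (c₁ * c₂)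
    (by rw [hL'def, e₂, hzs, ← hS2, hinv, smul_smul, Units.val_mul])
  have hback : ∀ X, L X = (c₁ : ℤ) • H2.congr S (L' X) := by
    intro X
    rw [hL'def, hzs, hsq, hinv']
  refine ⟨c₁, S * S', hS'.imp (fun h X => ?_) (fun h X => ?_)⟩
  · rw [hback, h, H2.congr_mul]
  · rw [hback, h, H2.congr_mul]

/-- Bijections of the hermitian matrices preserving coherency in both directions. -/
theorem exists_affine_of_coherent {φ : H2 → H2} (hb : Function.Bijective φ)
    (hφ : ∀ A B, H2.Coherent A B ↔ H2.Coherent (φ A) (φ B)) :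
    ∃ (c : ℤˣ) (S : GL (Fin 2) ℂ) (T : H2),
      (∀ X, φ X = (c : ℤ) • H2.congr S X + T) ∨
        ∀ X, φ X = (c : ℤ) • H2.congr S X.transpose + T := by
  have hφ' : PreservesNull detForm φ := by
    intro A B
    rw [detForm_self, detForm_self]
    have := hφ B A
    rw [H2.coherent_iff, H2.coherent_iff] at this
    simpa using this
  obtain ⟨L, hL⟩ := isLorentzian_detForm.exists_linear
    ⟨herm 1 0 0, by
      intro h
      have := detForm_herm 1 0 0 1 0 0
      rw [h] at this
      simp at this, by simp [detForm_herm]⟩ hb hφ'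
  obtain ⟨c, S, hS⟩ := exists_congr_of_linear L (by
    intro X
    have := hφ 0 X
    rw [H2.coherent_iff, H2.coherent_iff, hL X] at this
    simpa using this)
  refine ⟨c, S, φ 0, hS.imp (fun h X => ?_) (fun h X => ?_)⟩ <;> rw [hL, h]

/-! ## Rank one projections -/

/-- A singular R has the form uvᵗ, and then RAR = u(vᵗAu)vᵗ with vᵗAu = tr(RA). -/
theorem mul_mul_self_of_det_eq_zero {R : Matrix (Fin 2) (Fin 2) ℂ} (h : R.det = 0)
    (A : Matrix (Fin 2) (Fin 2) ℂ) : R * A * R = (R * A).trace • R := by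
  rw [Matrix.det_fin_two] at h
  ext i j
  fin_cases i <;> fin_cases j <;>
    simp [Matrix.mul_apply, Fin.sum_univ_two, Matrix.trace_fin_two]
  · linear_combination -(A 1 1) * h
  · linear_combination (A 0 1) * h
  · linear_combination (A 1 0) * h
  · linear_combination -(A 0 0) * h

theorem ofReal_re_trace_mul {M N : Matrix (Fin 2) (Fin 2) ℂ} (hM : M.IsHermitian)
    (hN : N.IsHermitian) : (((M * N).trace.re : ℝ) : ℂ) = (M * N).trace := by
  rw [← Complex.conj_eq_iff_re, starRingEnd_apply, ← Matrix.trace_conjTranspose,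
    Matrix.conjTranspose_mul, hM.eq, hN.eq, Matrix.trace_mul_comm]

theorem H2.isHermitian (A : H2) : (A : Matrix (Fin 2) (Fin 2) ℂ).IsHermitian := A.2

theorem Proj.trace_mat (P : Proj) : P.mat.trace = 1 := by
  have h := mul_mul_self_of_det_eq_zero P.det_mat 1
  rw [Matrix.mul_one, P.idem] at h
  by_contra hne
  apply P.mat_ne_zero
  have h1 : (P.mat.trace - 1) • P.mat = 0 := by rw [sub_smul, ← h, one_smul, sub_self]
  exact (smul_eq_zero.1 h1).resolve_left (sub_ne_zero.2 hne)

/-- In size two, adj P = (tr P)I - P. The adjugate reverses products, which makes the effect of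
congruence on P^⊥ computable. -/
theorem Proj.perp_eq_adjugate (P : Proj) : P.perp = P.mat.adjugate := by
  have h := P.trace_mat
  rw [Matrix.trace_fin_two] at h
  rw [Proj.perp, Matrix.adjugate_fin_two]
  ext i j
  fin_cases i <;> fin_cases j <;> simp
  · linear_combination -h
  · linear_combination -h

theorem Proj.det_perp (P : Proj) : P.perp.det = 0 := by
  rw [P.perp_eq_adjugate, Matrix.det_adjugate, P.det_mat]
  simp

theorem Proj.trace_perp (P : Proj) : P.perp.trace = 1 := by
  rw [Proj.perp, Matrix.trace_sub, P.trace_mat]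
  norm_num

theorem Proj.perp_ne_zero (P : Proj) : P.perp ≠ 0 := by
  intro h
  have := P.trace_perp
  simp [h] at this

theorem Proj.isHermitian_perp (P : Proj) : P.perp.IsHermitian :=
  Matrix.isHermitian_one.sub P.herm

theorem Proj.perp_mul_self (P : Proj) : P.perp * P.perp = P.perp := by
  have h := mul_mul_self_of_det_eq_zero P.det_perp 1
  rwa [Matrix.mul_one, P.trace_perp, one_smul] at h

/-- As P^⊥ has rank one, the matrix equation is a single scalar equation, real because both factors
are hermitian. -/
theorem Proj.perp_mul_mul_perp_eq_iff (P : Proj) (A : H2) (a : ℝ) :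
    P.perp * (A : Matrix (Fin 2) (Fin 2) ℂ) * P.perp = (a : ℂ) • P.perp ↔
      (P.perp * (A : Matrix (Fin 2) (Fin 2) ℂ)).trace.re = a := by
  rw [mul_mul_self_of_det_eq_zero P.det_perp]
  constructor
  · intro h
    rw [smul_left_injective ℂ P.perp_ne_zero h, Complex.ofReal_re]
  · rintro rfl
    rw [ofReal_re_trace_mul P.isHermitian_perp A.isHermitian]

theorem Proj.transpose_transpose (P : Proj) : P.transpose.transpose = P := by
  ext1
  exact Matrix.transpose_transpose _

theorem Proj.congr_mul (S S' : GL (Fin 2) ℂ) (P : Proj) :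
    Proj.congr (S * S') P = Proj.congr S (Proj.congr S' P) := by
  ext1
  have ht := Proj.trace_congr_ne_zero S' P
  simp only [Proj.congr, Units.val_mul, Matrix.conjTranspose_mul, Matrix.mul_smul, Matrix.smul_mul,
    Matrix.trace_smul, smul_smul, smul_eq_mul, mul_inv, inv_inv, Matrix.mul_assoc] at ht ⊢
  congr 1
  field_simp

theorem Proj.congr_one (P : Proj) : Proj.congr 1 P = P := by
  ext1
  simp [Proj.congr, P.trace_mat]

/-- `S* Q^⊥ S` is a multiple of `P^⊥`, where `Q` is the projection onto `S (im P)`. -/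
theorem Proj.exists_conj_perp_congr (S : GL (Fin 2) ℂ) (P : Proj) : ∃ k : ℂ, k ≠ 0 ∧
    (S : Matrix (Fin 2) (Fin 2) ℂ)ᴴ * (P.congr S).perp * (S : Matrix (Fin 2) (Fin 2) ℂ) =
      k • P.perp := by
  have hS := det_coe_ne_zero S
  have ht := Proj.trace_congr_ne_zero S P
  have hS' : ((S : Matrix (Fin 2) (Fin 2) ℂ)ᴴ).det ≠ 0 := by
    rw [Matrix.det_conjTranspose]; simpa using hS
  -- The witness is (tr SPS*)⁻¹ det S* det S: the determinants come from S* adj(S*) and adj(S) S.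
  refine ⟨_, mul_ne_zero (inv_ne_zero ht) (mul_ne_zero hS' hS), ?_⟩
  rw [Proj.perp_eq_adjugate, Proj.perp_eq_adjugate, Proj.congr, Matrix.adjugate_smul,
    Matrix.adjugate_mul_distrib, Matrix.adjugate_mul_distrib]
  simp only [Fintype.card_fin, Nat.add_one_sub_one, pow_one, Matrix.mul_smul, Matrix.smul_mul]
  rw [mul_smul, ← Matrix.mul_assoc, Matrix.mul_adjugate, Matrix.mul_assoc, Matrix.mul_assoc,
    Matrix.mul_assoc, Matrix.adjugate_mul]
  simp only [Matrix.smul_mul, Matrix.mul_smul, Matrix.one_mul, Matrix.mul_one, smul_smul]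
  rw [mul_comm (S : Matrix (Fin 2) (Fin 2) ℂ).det]

/-- Cyclicity of the trace reduces this to S*Q^⊥S = kP^⊥. It shows that the factor tr(Q^⊥SS*)
prescribed at infinity is the one that preserves coherency with hermitian matrices. -/
theorem Proj.trace_perp_congr (S : GL (Fin 2) ℂ) (P : Proj) : ∃ k : ℝ, k ≠ 0 ∧
    (((P.congr S).perp * ((S : Matrix (Fin 2) (Fin 2) ℂ) *
        (S : Matrix (Fin 2) (Fin 2) ℂ)ᴴ)).trace.re = k) ∧
    ∀ A : H2, ((P.congr S).perp * (H2.congr S A : Matrix (Fin 2) (Fin 2) ℂ)).trace.re =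
      (P.perp * (A : Matrix (Fin 2) (Fin 2) ℂ)).trace.re * k := by
  obtain ⟨k, hk, h⟩ := P.exists_conj_perp_congr S
  have h1 : ∀ A : H2, ((P.congr S).perp * (H2.congr S A : Matrix (Fin 2) (Fin 2) ℂ)).trace =
      k * (P.perp * (A : Matrix (Fin 2) (Fin 2) ℂ)).trace := by
    intro A
    rw [H2.congr, ← Matrix.mul_assoc, Matrix.trace_mul_comm, ← Matrix.mul_assoc,
      ← Matrix.mul_assoc, h, Matrix.smul_mul, Matrix.trace_smul, smul_eq_mul]
  have h2 : ((P.congr S).perp * ((S : Matrix (Fin 2) (Fin 2) ℂ) *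
      (S : Matrix (Fin 2) (Fin 2) ℂ)ᴴ)).trace = k := by
    rw [← Matrix.mul_assoc, Matrix.trace_mul_comm, ← Matrix.mul_assoc, h, Matrix.trace_smul,
      P.trace_perp, smul_eq_mul, mul_one]
  have h3 : ((k.re : ℝ) : ℂ) = k := by
    rw [← h2]
    exact ofReal_re_trace_mul (P.congr S).isHermitian_perp
      (Matrix.isHermitian_mul_conjTranspose_self _)
  refine ⟨k.re, ?_, by rw [h2], fun A => ?_⟩
  · intro h0
    rw [h0] at h3
    exact hk (by simpa using h3.symm)
  · rw [h1, ← h3, Complex.re_ofReal_mul, Complex.ofReal_re, mul_comm]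

/-! ## Automorphisms of the compactification -/

namespace HBar

theorem coherent_comm (X Y : HBar) : Coherent X Y ↔ Coherent Y X := by
  have h : ∀ A B : H2, H2.Coherent A B ↔ H2.Coherent B A := by
    intro A B
    rw [H2.coherent_iff, H2.coherent_iff, ← neg_sub, H2.det_neg]
  rcases X with A | ⟨P, a⟩ | _ <;> rcases Y with B | ⟨Q, b⟩ | _ <;> simp [Coherent, h _ _, eq_comm]

theorem coherent_half_fin (P : Proj) (a : ℝ) (A : H2) :
    Coherent (half P a) (fin A) ↔ (P.perp * (A : Matrix (Fin 2) (Fin 2) ℂ)).trace.re = a :=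
  P.perp_mul_mul_perp_eq_iff A a

/-- A map that acts on each of the three kinds of points and preserves coherency is an
automorphism as soon as it is bijective. -/
theorem isAutomorphism_of_apply {ψ : HBar → HBar} (hb : Function.Bijective ψ) {f : H2 → H2}
    {g : Proj → Proj} {k : Proj → ℝ → ℝ} (hf : ∀ A, ψ (fin A) = fin (f A))
    (hh : ∀ P a, ψ (half P a) = half (g P) (k P a)) (hi : ψ infty = infty)
    (hff : ∀ A B, H2.Coherent A B ↔ H2.Coherent (f A) (f B)) (hg : Function.Injective g)
    (hfh : ∀ P a A, Coherent (half P a) (fin A) ↔ Coherent (half (g P) (k P a)) (fin (f A))) :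
    IsAutomorphism ψ := by
  refine ⟨hb, ?_⟩
  intro X Y
  rcases X with A | ⟨P, a⟩ | _ <;> rcases Y with B | ⟨Q, b⟩ | _ <;> simp only [hf, hh, hi]
  · exact hff A B
  · rw [coherent_comm, hfh, coherent_comm]
  · rfl
  · exact hfh P a B
  · exact hg.eq_iff.symm
  · rfl
  · rfl
  · rfl

theorem IsAutomorphism.comp {ψ χ : HBar → HBar} (h : IsAutomorphism ψ) (h' : IsAutomorphism χ) :
    IsAutomorphism (fun X => ψ (χ X)) :=
  ⟨h.1.comp h'.1, fun X Y => (h'.2 X Y).trans (h.2 _ _)⟩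

theorem isAutomorphism_translate (B : H2) : IsAutomorphism (translate B) := by
  refine isAutomorphism_of_apply (f := fun A => A + B) (g := id) (Function.bijective_iff_has_inverse.2
    ⟨translate (-B), ?_, ?_⟩) (fun _ => rfl) (fun _ _ => rfl) rfl ?_ Function.injective_id ?_
  · rintro (A | ⟨P, a⟩ | _) <;> simp [translate]
  · rintro (A | ⟨P, a⟩ | _) <;> simp [translate]
  · intro A A'
    simp [H2.coherent_iff]
  · intro P a A
    rw [coherent_half_fin, coherent_half_fin]
    simp [Matrix.mul_add]

theorem isAutomorphism_signMul (c : ℤˣ) : IsAutomorphism (signMul c) := by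
  refine isAutomorphism_of_apply (f := fun A => (c : ℤ) • A) (g := id)
    (Function.bijective_iff_has_inverse.2 ⟨signMul c, ?_, ?_⟩) (fun _ => rfl) (fun _ _ => rfl) rfl
    ?_ Function.injective_id ?_ <;> rcases Int.units_eq_one_or c with rfl | rfl
  · rintro (A | ⟨P, a⟩ | _) <;> simp [signMul]
  · rintro (A | ⟨P, a⟩ | _) <;> simp [signMul]
  · rintro (A | ⟨P, a⟩ | _) <;> simp [signMul]
  · rintro (A | ⟨P, a⟩ | _) <;> simp [signMul]
  · simp
  · intro A B
    rw [H2.coherent_iff, H2.coherent_iff, ← H2.det_neg]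
    simp [neg_add_eq_sub]
  · intro P a A
    simp
  · intro P a A
    rw [coherent_half_fin, coherent_half_fin]
    simp

theorem isAutomorphism_transpose : IsAutomorphism transpose := by
  have hinv : Function.Involutive transpose := by
    rintro (A | ⟨P, a⟩ | _)
    · rfl
    · simp [transpose, P.transpose_transpose]
    · rfl
  refine isAutomorphism_of_apply hinv.bijective (fun _ => rfl) (fun _ _ => rfl) rfl ?_
    (Function.Involutive.injective Proj.transpose_transpose) ?_
  · intro A B
    rw [H2.coherent_iff, H2.coherent_iff, ← H2.det_transpose]
    rfl
  · intro P a A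
    have h : P.transpose.perp = P.perpᵀ := by
      simp [Proj.perp, Proj.transpose]
    rw [coherent_half_fin, coherent_half_fin, h, H2.transpose, ← Matrix.transpose_mul,
      Matrix.trace_transpose, Matrix.trace_mul_comm]

theorem isAutomorphism_congr (S : GL (Fin 2) ℂ) : IsAutomorphism (congr S) := by
  have hfh : ∀ (S : GL (Fin 2) ℂ) (P : Proj) (a : ℝ) (A : H2), Coherent (half P a) (fin A) ↔
      Coherent (congr S (half P a)) (fin (H2.congr S A)) := by
    intro S P a A
    obtain ⟨k, hk0, hk, h⟩ := P.trace_perp_congr S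
    rw [congr, hk, coherent_half_fin, coherent_half_fin, h, mul_left_inj' hk0]
  have hPinv : ∀ (S : GL (Fin 2) ℂ) (P : Proj), Proj.congr S⁻¹ (Proj.congr S P) = P := by
    intro S P
    rw [← Proj.congr_mul, inv_mul_cancel, Proj.congr_one]
  have hAinv : ∀ (S : GL (Fin 2) ℂ) (A : H2), H2.congr S⁻¹ (H2.congr S A) = A := by
    intro S P
    rw [← H2.congr_mul, inv_mul_cancel, H2.congr_one]
  have hinv : ∀ S : GL (Fin 2) ℂ, Function.LeftInverse (congr S⁻¹) (congr S) := by
    rintro S (A | ⟨P, a⟩ | _)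
    · simp only [congr, hAinv]
    · -- both points are coherent to the same hermitian matrix `a P^⊥`
      let A : H2 := ⟨(a : ℂ) • P.perp, by
        change star _ = _
        rw [star_smul, Matrix.star_eq_conjTranspose, P.isHermitian_perp.eq]
        simp⟩
      have hA : Coherent (half P a) (fin A) := by
        rw [coherent_half_fin]
        simp [A, P.perp_mul_self, P.trace_perp]
      have h1 := (hfh S⁻¹ _ _ _).1 ((hfh S _ _ _).1 hA)
      rw [hAinv] at h1
      simp only [congr, hPinv] at h1 ⊢
      rw [coherent_half_fin] at hA h1
      rw [← h1, hA]
    · rfl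
  refine isAutomorphism_of_apply (Function.bijective_iff_has_inverse.2 ⟨congr S⁻¹, hinv S, ?_⟩)
    (fun _ => rfl) (fun _ _ => rfl) rfl ?_ ?_ (hfh S)
  · have := hinv S⁻¹
    rwa [inv_inv] at this
  · intro A B
    rw [H2.coherent_iff, H2.coherent_iff, ← H2.congrLin_apply, ← H2.congrLin_apply, ← map_sub,
      H2.congrLin_apply, H2.det_congr, mul_eq_zero]
    simp [det_coe_ne_zero]
  · exact (Function.LeftInverse.injective (hPinv S))

end HBar

theorem exists_affine_automorphism {φ : H2 → H2} (hb : Function.Bijective φ)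
    (hφ : ∀ A B, H2.Coherent A B ↔ H2.Coherent (φ A) (φ B)) :
    ∃ ψ : HBar → HBar, HBar.IsAffineAutomorphism ψ ∧ ∀ A, ψ (.fin A) = .fin (φ A) := by
  obtain ⟨c, S, T, h | h⟩ := exists_affine_of_coherent hb hφ
  · refine ⟨fun X => .translate T (.signMul c (.congr S X)), ⟨?_, c, S, T, .inl fun _ => rfl⟩, ?_⟩
    · exact (HBar.isAutomorphism_translate T).comp
        ((HBar.isAutomorphism_signMul c).comp (HBar.isAutomorphism_congr S))
    · intro A
      rw [h]
      rfl
  · refine ⟨fun X => .translate T (.signMul c (.congr S (.transpose X))),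
      ⟨?_, c, S, T, .inr fun _ => rfl⟩, ?_⟩
    · exact (HBar.isAutomorphism_translate T).comp ((HBar.isAutomorphism_signMul c).comp
        ((HBar.isAutomorphism_congr S).comp HBar.isAutomorphism_transpose))
    · intro A
      rw [h]
      rfl

/-! ## Minkowski spacetime -/

/-- Events as hermitian matrices. -/
noncomputable def eventEquiv : M4 ≃ₗ[ℝ] H2 where
  toFun r := herm (r 3 + r 2) (r 3 - r 2) ⟨r 0, r 1⟩
  map_add' r s := by
    rw [herm_add]
    congr 1
    · simp; ring
    · simp; ring
  map_smul' c r := by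
    rw [smul_herm]
    congr 1
    · simp; ring
    · simp; ring
    · apply Complex.ext <;> simp
  invFun A := ![((A : Matrix (Fin 2) (Fin 2) ℂ) 0 1).re, ((A : Matrix (Fin 2) (Fin 2) ℂ) 0 1).im,
    (((A : Matrix (Fin 2) (Fin 2) ℂ) 0 0).re - ((A : Matrix (Fin 2) (Fin 2) ℂ) 1 1).re) / 2,
    (((A : Matrix (Fin 2) (Fin 2) ℂ) 0 0).re + ((A : Matrix (Fin 2) (Fin 2) ℂ) 1 1).re) / 2]
  left_inv r := by
    ext i
    fin_cases i <;> simp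
  right_inv A := by
    obtain ⟨s, t, z, rfl⟩ := exists_eq_herm A
    simp
    congr 1 <;> ring

theorem det_eventEquiv (r : M4) : (eventEquiv r).det = lorentzInner r r := by
  change (herm _ _ _).det = _
  rw [det_herm, lorentzInner]
  ring

theorem lorentzInner_eq_dotProduct (r s : M4) : lorentzInner r s = r ⬝ᵥ lorentzM *ᵥ s := by
  simp [lorentzInner, lorentzM, dotProduct, Fin.sum_univ_four, Matrix.mulVec_diagonal]
  ring

theorem lorentzInner_polarization (r s : M4) : 2 * lorentzInner r s =
    lorentzInner (r + s) (r + s) - lorentzInner r r - lorentzInner s s := by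
  simp [lorentzInner]
  ring

theorem isLorentzMatrix_of_forall {Q : Matrix (Fin 4) (Fin 4) ℝ}
    (h : ∀ r, lorentzInner (Q *ᵥ r) (Q *ᵥ r) = lorentzInner r r) : IsLorentzMatrix Q := by
  have h' : ∀ r s, lorentzInner (Q *ᵥ r) (Q *ᵥ s) = lorentzInner r s := by
    intro r s
    have h1 := lorentzInner_polarization (Q *ᵥ r) (Q *ᵥ s)
    rw [← Matrix.mulVec_add, h, h, h, ← lorentzInner_polarization] at h1
    linarith
  rw [IsLorentzMatrix]
  apply Matrix.ext_of_mulVec_single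
  intro j
  ext i
  have h1 := h' (Pi.single i 1) (Pi.single j 1)
  rw [lorentzInner_eq_dotProduct, lorentzInner_eq_dotProduct, single_one_dotProduct] at h1
  rw [← h1, ← single_one_dotProduct i ((Qᵀ * lorentzM * Q) *ᵥ _), ← Matrix.mulVec_mulVec,
    ← Matrix.mulVec_mulVec, Matrix.dotProduct_mulVec _ Qᵀ, Matrix.vecMul_transpose]

/-- Sign and transposition preserve `det`, while S multiplies it by |det S|². Dividing the linear
part by k = |det S| therefore yields an isometry of the Lorentz form. -/
theorem exists_lorentz_of_lightlike {φ : M4 → M4} (hb : Function.Bijective φ)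
    (hφ : ∀ r s, Lightlike r s ↔ Lightlike (φ r) (φ s)) :
    ∃ (c : ℝ) (Q : Matrix (Fin 4) (Fin 4) ℝ) (a : M4),
      0 < c ∧ IsLorentzMatrix Q ∧ ∀ r : M4, φ r = c • (Q.mulVec r) + a := by
  have hco : ∀ r s, Lightlike s r ↔ H2.Coherent (eventEquiv r) (eventEquiv s) := by
    intro r s
    rw [H2.coherent_iff, ← map_sub, det_eventEquiv, Lightlike]
  obtain ⟨c, S, T, h⟩ := exists_affine_of_coherent
    (φ := fun A => eventEquiv (φ (eventEquiv.symm A)))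
    (eventEquiv.bijective.comp (hb.comp eventEquiv.symm.bijective)) (by
      intro A B
      rw [← hco, ← hφ, hco, LinearEquiv.apply_symm_apply, LinearEquiv.apply_symm_apply])
  obtain ⟨L, hL, hdet⟩ : ∃ L : H2 →ₗ[ℝ] H2,
      (∀ A, eventEquiv (φ (eventEquiv.symm A)) = L A + T) ∧
      ∀ A, (L A).det = ‖(S : Matrix (Fin 2) (Fin 2) ℂ).det‖ ^ 2 * A.det := by
    have hc : ∀ A : H2, ((c : ℤ) • A).det = A.det := by
      intro A
      rcases Int.units_eq_one_or c with rfl | rfl <;> simp [H2.det_neg]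
    have htr : ∃ M : H2 →ₗ[ℝ] H2, ∀ A, M A = A.transpose :=
      ⟨{ toFun := H2.transpose, map_add' := fun _ _ => rfl, map_smul' := fun _ _ => rfl },
        fun _ => rfl⟩
    obtain ⟨M, hM⟩ := htr
    rcases h with h | h
    · exact ⟨(c : ℤ) • H2.congrLin S, h, fun A => (hc _).trans (H2.det_congr S A)⟩
    · refine ⟨(c : ℤ) • (H2.congrLin S ∘ₗ M), fun A => ?_, fun A => ?_⟩
      · rw [h, ← hM]
        rfl
      · refine (hc _).trans ((H2.det_congr S _).trans ?_)
        rw [hM, H2.det_transpose]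
  set k := ‖(S : Matrix (Fin 2) (Fin 2) ℂ).det‖
  have hk : 0 < k := norm_pos_iff.2 (det_coe_ne_zero S)
  let L' : M4 →ₗ[ℝ] M4 := k⁻¹ • (eventEquiv.symm.toLinearMap ∘ₗ L ∘ₗ eventEquiv.toLinearMap)
  have hL' : ∀ r, eventEquiv (L' r) = k⁻¹ • L (eventEquiv r) := by
    intro r
    simp [L']
  have hdk : ∀ (x : ℝ) (A : H2), (x • A).det = x ^ 2 * A.det := by
    intro x A
    obtain ⟨s, t, z, rfl⟩ := exists_eq_herm A
    rw [smul_herm, det_herm, det_herm]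
    simp
    ring
  refine ⟨k, LinearMap.toMatrix' L', eventEquiv.symm T, hk, isLorentzMatrix_of_forall ?_, ?_⟩
  · intro r
    rw [LinearMap.toMatrix'_mulVec, ← det_eventEquiv, ← det_eventEquiv, hL', hdk, hdet]
    field_simp
  · intro r
    apply eventEquiv.injective
    have := hL (eventEquiv r)
    rw [LinearEquiv.symm_apply_apply] at this
    rw [this, LinearMap.toMatrix'_mulVec, map_add, map_smul, hL', smul_smul,
      mul_inv_cancel₀ hk.ne', one_smul, LinearEquiv.apply_symm_apply]

end Chronogeometry

theorem mainTheorem7 :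
    (∀ φ : Chronogeometry.H2 → Chronogeometry.H2, Function.Bijective φ →
      (∀ A B : Chronogeometry.H2,
        Chronogeometry.H2.Coherent A B ↔ Chronogeometry.H2.Coherent (φ A) (φ B)) →
      ∃ ψ : Chronogeometry.HBar → Chronogeometry.HBar,
        Chronogeometry.HBar.IsAffineAutomorphism ψ ∧
        ∀ A : Chronogeometry.H2,
          ψ (Chronogeometry.HBar.fin A) = Chronogeometry.HBar.fin (φ A)) ∧
    (∀ φ : Chronogeometry.M4 → Chronogeometry.M4, Function.Bijective φ →
      (∀ r s : Chronogeometry.M4,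
        Chronogeometry.Lightlike r s ↔ Chronogeometry.Lightlike (φ r) (φ s)) →
      ∃ (c : ℝ) (Q : Matrix (Fin 4) (Fin 4) ℝ) (a : Chronogeometry.M4),
        0 < c ∧ Chronogeometry.IsLorentzMatrix Q ∧
        ∀ r : Chronogeometry.M4, φ r = c • (Q.mulVec r) + a) :=
  ⟨fun _ hb h => Chronogeometry.exists_affine_automorphism hb h,
    fun _ hb h => Chronogeometry.exists_lorentz_of_lightlike hb h⟩
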